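/- **Generic bar-slider rigidity.** A *looped graph* $G=(V,E)$ is a finite graph whose edges join two distinct vertices and which may also have self-loops (parallel edges and several loops at a vertex are allowed); it has $n$ vertices, $m$ edges and $c$ loops. $G$ is *looped-Laman* (that is, $(2,0,3)$-tight) if - every set of $n'\ge 2$ vertices induces at most $2n'-3$ edges, - every set of $n'$ vertices induces at most $2n'$ edges and loops in total, and - $m+c=2n$. A *bar-slider framework* $(G,\boldsymbol\ell,\mathbf n,\mathbf s)$ consists of a looped graph $G$, a squared length $\ell_{ij}>0$ for each edge $ij$, and a line $\{x\in\mathbb R^2:\langle x,\mathbf n_{i_j}\rangle=s_{i_j}\}$ with $\mathbf n_{i_j}\ne 0$ (a slider) for each loop $i_j$, the $j$th loop at vertex $i$. Its *configuration space* $\mathcal C(G)\subset(\mathbb R^2)^n$ is the set of all $\mathbf p$ with $\|\mathbf p_i-\mathbf p_j\|^2=\ell_{ij}$ for every edge $ij$ and $\langle\mathbf p_i,\mathbf n_{i_j}\rangle=s_{i_j}$ for every loop $i_j$; its points are called *realizations* $G(\mathbf p)$. A realization $G(\mathbf p)$ is *pinned* (slider-pinning rigid) if $\mathbf p$ is an isolated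 point of $\mathcal C(G)$, and *minimally pinned* if it is pinned but fails to remain so if any one edge or loop is removed from the framework. The *pinned rigidity matrix* $\mathbf M_{2,0,3}(G(\mathbf p))$ has $m+c$ rows and $2n$ columns, two for each vertex. The row of an edge $ij$ has the entries of $\mathbf p_i-\mathbf p_j$ in the columns of $i$, those of $\mathbf p_j-\mathbf p_i$ in the columns of $j$, and zeros elsewhere; the row of a loop $i_j$ has the entries of $\mathbf n_{i_j}$ in the columns of $i$ and zeros elsewhere. The realization $G(\mathbf p)$ is *generic* if the rank of this matrix is the maximum of the ranks of the matrices of the same form over all choices of points in $(\mathbb R^2)^n$ and of normal vectors in $(\mathbb R^2)^c$. **Theorem.** Let $G(\mathbf p)$ be a generic realization of a bar-slider framework $(G,\boldsymbol\ell,\mathbf n,\mathbf s)$. Then $G(\mathbf p)$ is minimally pinned if and only if $G$ is looped-Laman. -/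

import Mathlib

open Filter Topology

/-- The Euclidean plane. -/
abbrev Plane : Type := EuclideanSpace ℝ (Fin 2)

/-- A looped graph with vertex set `V`, edge set `E` and self-loop set `L`.  An edge joins an unordered
pair of distinct vertices.  Parallel edges and several loops at the same vertex are allowed. -/
structure LoopedGraph (V E L : Type*) where
  /-- the two ends of an edge -/
  ends : E → Sym2 V
  /-- the ends of an edge are distinct -/
  ends_not_isDiag : ∀ e, ¬ (ends e).IsDiag
  /-- the vertex at which a loop sits -/
  base : L → V

namespace LoopedGraph

variable {V E L : Type*}

/-- The edges induced by a set of vertices. -/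
def inducedEdges (G : LoopedGraph V E L) (S : Finset V) : Set E :=
  {e | ∀ v ∈ G.ends e, v ∈ S}

/-- The loops induced by a set of vertices. -/
def inducedLoops (G : LoopedGraph V E L) (S : Finset V) : Set L :=
  {l | G.base l ∈ S}

/-- `(2,0,3)`-graded-sparsity: the edges alone are `(2,3)`-sparse, and edges and loops together are
`(2,0)`-sparse.  As always for `(2,3)`-sparsity, the first bound concerns subgraphs on at least two
vertices (a single vertex induces no edge). -/
structure IsGradedSparse (G : LoopedGraph V E L) : Prop where
  edges_sparse : ∀ S : Finset V, 2 ≤ S.card →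
    (G.inducedEdges S).ncard + 3 ≤ 2 * S.card
  sparse : ∀ S : Finset V,
    (G.inducedEdges S).ncard + (G.inducedLoops S).ncard ≤ 2 * S.card

/-- Looped-Laman graphs, that is, `(2,0,3)`-tight graphs. -/
structure IsLoopedLaman [Fintype V] [Fintype E] [Fintype L] (G : LoopedGraph V E L) : Prop
    extends G.IsGradedSparse where
  tight : Fintype.card E + Fintype.card L = 2 * Fintype.card V

/-- Remove an edge. -/
def deleteEdge (G : LoopedGraph V E L) (e : E) : LoopedGraph V {e' : E // e' ≠ e} L where
  ends e' := G.ends e'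
  ends_not_isDiag e' := G.ends_not_isDiag e'
  base := G.base

/-- Remove a loop. -/
def deleteLoop (G : LoopedGraph V E L) (l : L) : LoopedGraph V E {l' : L // l' ≠ l} where
  ends := G.ends
  ends_not_isDiag := G.ends_not_isDiag
  base l' := G.base l'

open Classical in
/-- The pinned rigidity matrix at the points `p` with slider normals `ν`.  The row of an edge `ij` has
the entries `p i - p j` in the two columns of `i`, the entries `p j - p i` in the two columns of `j`,
and zeros elsewhere (the sum below has at most one nonzero term).  The row of a loop at `i` has its
normal vector in the two columns of `i`, and zeros elsewhere. -/
noncomputable def rigidityMatrix [Fintype V] (G : LoopedGraph V E L)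
    (p : V → Plane) (ν : L → Plane) : Matrix (E ⊕ L) (V × Fin 2) ℝ :=
  Matrix.of fun r c =>
    match r with
    | Sum.inl e => ∑ w : V, if G.ends e = s(c.1, w) then p c.1 c.2 - p w c.2 else 0
    | Sum.inr l => if G.base l = c.1 then ν l c.2 else 0

end LoopedGraph

/-- An abstract bar-slider framework: a looped graph together with a positive squared length for each
edge, and a line `⟪x, normal⟫ = offset` for each loop. -/
structure BarSliderFramework (V E L : Type*) where
  /-- the underlying looped graph -/
  graph : LoopedGraph V E L
  /-- the squared edge lengths -/
  lengthSq : E → ℝ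
  lengthSq_pos : ∀ e, 0 < lengthSq e
  /-- the normal vectors of the slider lines -/
  normal : L → Plane
  normal_ne_zero : ∀ l, normal l ≠ 0
  /-- the constants in the equations of the slider lines -/
  offset : L → ℝ

namespace BarSliderFramework

variable {V E L : Type*}

/-- The configuration space: all point sets that realize the framework. -/
def configurationSpace (F : BarSliderFramework V E L) : Set (V → Plane) :=
  {p | (∀ e i j, F.graph.ends e = s(i, j) → ‖p i - p j‖ ^ 2 = F.lengthSq e) ∧
    ∀ l, inner ℝ (p (F.graph.base l)) (F.normal l) = F.offset l}

/-- The realization `p` is pinned: it is an isolated point of the configuration space. -/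
def IsPinned (F : BarSliderFramework V E L) (p : V → Plane) : Prop :=
  p ∈ F.configurationSpace ∧ ∀ᶠ q in 𝓝 p, q ∈ F.configurationSpace → q = p

/-- Remove a bar. -/
def deleteEdge (F : BarSliderFramework V E L) (e : E) :
    BarSliderFramework V {e' : E // e' ≠ e} L where
  graph := F.graph.deleteEdge e
  lengthSq e' := F.lengthSq e'
  lengthSq_pos e' := F.lengthSq_pos e'
  normal := F.normal
  normal_ne_zero := F.normal_ne_zero
  offset := F.offset

/-- Remove a slider. -/
def deleteLoop (F : BarSliderFramework V E L) (l : L) :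
    BarSliderFramework V E {l' : L // l' ≠ l} where
  graph := F.graph.deleteLoop l
  lengthSq := F.lengthSq
  lengthSq_pos := F.lengthSq_pos
  normal l' := F.normal l'
  normal_ne_zero l' := F.normal_ne_zero l'
  offset l' := F.offset l'

/-- The realization `p` is minimally pinned: it is pinned, but fails to remain so if any edge or
loop is removed. -/
def IsMinimallyPinned (F : BarSliderFramework V E L) (p : V → Plane) : Prop :=
  F.IsPinned p ∧ (∀ e, ¬ (F.deleteEdge e).IsPinned p) ∧ ∀ l, ¬ (F.deleteLoop l).IsPinned p

/-- The realization `p` is generic: the pinned rigidity matrix attains at `p` and at the normals of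
the sliders its maximum rank over all point sets and all choices of normals (this maximum is the rank
of the matrix of the same pattern whose coordinates and normals are formal variables). -/
def IsGeneric [Fintype V] (F : BarSliderFramework V E L) (p : V → Plane) : Prop :=
  ∀ (q : V → Plane) (ν : L → Plane),
    (F.graph.rigidityMatrix q ν).rank ≤ (F.graph.rigidityMatrix p F.normal).rank

end BarSliderFramework

/-! Everything reduces to bijectivity of the linear map of the pinned rigidity matrix,
`rigidityMap`, at the generic point. Up to a factor it is the derivative of the map whose fibre is
the configuration space. If it is injective, the point is isolated
(`eventually_eq_of_fderiv_injective`). If it has maximal rank and a kernel, a constant-rank argument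
gives a curve in the fibre through the point (`not_eventually_eq_of_rank_le`). So a generic pinned
realization has an injective rigidity map, and minimality excludes redundant rows, which makes the
map onto. Conversely, deleting a row from a bijective map leaves a map that is onto but not
injective.

If the map is bijective, `G` is sparse: the rows supported on a vertex set are independent, and the
edge rows among them vanish on the three-dimensional space of infinitesimal rigid motions
(`isGradedSparse_of_surjective`). The count `m + c = 2n` says that the matrix is square.

The hard direction is to find one realization of a sparse graph with independent rows; genericity
then transfers the rank. First the edge vectors are decoupled from the points: each edge or loop
gets an arbitrary vector, so its row ranges over a subspace of functionals. Rado's theorem, with a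
component-by-component count, provides independent rows (`exists_linearIndependent_frameForm`). Next
one seeks points whose edge differences are perpendicular to the chosen vectors. A solution could
collapse an edge, but the graph with that edge doubled still satisfies the required count, so for
generic vectors some solution keeps it uncollapsed. Avoiding finitely many proper subspaces gives a
solution that collapses no edge, and a quarter turn converts the frame rows into rigidity rows up to
nonzero scalars (`IsGradedSparse.exists_linearIndependent`). -/

/-! ### Isolated points of fibres of differentiable maps -/

/-- If the derivative of `f` at `p` is injective, then `p` is isolated in its fibre. -/
theorem eventually_eq_of_fderiv_injective {W Y : Type*} [NormedAddCommGroup W] [NormedSpace ℝ W]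
    [FiniteDimensional ℝ W] [NormedAddCommGroup Y] [NormedSpace ℝ Y] {f : W → Y} {f' : W →L[ℝ] Y}
    {p : W} (hf : HasFDerivAt f f' p) (hinj : Function.Injective f') :
    ∀ᶠ q in 𝓝 p, f q = f p → q = p := by
  obtain ⟨C, -, hC⟩ := LinearMap.exists_antilipschitzWith (f' : W →ₗ[ℝ] Y)
    (LinearMap.ker_eq_bot.2 hinj)
  have h := hf.eventually_ne (c := f p) ⟨C, hC⟩
  rw [eventually_nhdsWithin_iff] at h
  filter_upwards [h] with q hq hfq
  by_contra hne
  exact hq hne hfq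

/-- A linear map whose composition with `π` is onto a space of at least its own rank has the same
kernel as that composition. -/
theorem eq_zero_of_comp_surjective {W Y Z : Type*} [AddCommGroup W] [Module ℝ W]
    [AddCommGroup Y] [Module ℝ Y] [AddCommGroup Z] [Module ℝ Z] [FiniteDimensional ℝ W]
    [FiniteDimensional ℝ Z] {A : W →ₗ[ℝ] Y} {π : Y →ₗ[ℝ] Z}
    (hs : Function.Surjective (π ∘ₗ A))
    (hr : Module.finrank ℝ (LinearMap.range A) ≤ Module.finrank ℝ Z)
    {x : W} (hx : π (A x) = 0) : A x = 0 := by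
  have hs' : Function.Surjective (π.domRestrict (LinearMap.range A)) := by
    intro z
    obtain ⟨w, rfl⟩ := hs z
    exact ⟨⟨A w, w, rfl⟩, rfl⟩
  have heq : Module.finrank ℝ (LinearMap.range A) = Module.finrank ℝ Z :=
    le_antisymm hr (LinearMap.finrank_le_finrank_of_surjective hs')
  have hinj := (LinearMap.injective_iff_surjective_of_finrank_eq_finrank heq).2 hs'
  have : (⟨A x, x, rfl⟩ : LinearMap.range A) = 0 := hinj (by simpa using hx)
  simpa using congrArg Subtype.val this

/-- If the derivative of `f` has maximal rank at `p` and is not injective there, then `p` is not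
isolated in its fibre. -/
theorem not_eventually_eq_of_rank_le {W Y : Type*} [NormedAddCommGroup W] [NormedSpace ℝ W]
    [FiniteDimensional ℝ W] [NormedAddCommGroup Y] [NormedSpace ℝ Y] [FiniteDimensional ℝ Y]
    {f : W → Y} {f' : W → W →L[ℝ] Y} (hf : ∀ q, HasFDerivAt f (f' q) q) (hc : ContDiff ℝ 1 f)
    {p : W}
    (hrank : ∀ q, Module.finrank ℝ (LinearMap.range (f' q : W →ₗ[ℝ] Y)) ≤
      Module.finrank ℝ (LinearMap.range (f' p : W →ₗ[ℝ] Y)))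
    (hni : ¬ Function.Injective (f' p)) :
    ¬ ∀ᶠ q in 𝓝 p, f q = f p → q = p := by
  intro hiso
  set R := LinearMap.range (f' p : W →ₗ[ℝ] Y) with hR
  set N := LinearMap.ker (f' p : W →ₗ[ℝ] Y) with hN
  obtain ⟨v, hvN, hv0⟩ : ∃ v ∈ N, v ≠ 0 := by
    by_contra! h
    exact hni (LinearMap.ker_eq_bot.1 ((Submodule.eq_bot_iff _).2 h))
  obtain ⟨π₀, hπ₀⟩ := LinearMap.exists_leftInverse_of_injective R.subtype (by simp)
  obtain ⟨κ₀, hκ₀⟩ := LinearMap.exists_leftInverse_of_injective N.subtype (by simp)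
  let π : Y →L[ℝ] R := LinearMap.toContinuousLinearMap π₀
  let κ : W →L[ℝ] N := LinearMap.toContinuousLinearMap κ₀
  have hπ : ∀ r : R, π (r : Y) = r := fun r => LinearMap.congr_fun hπ₀ r
  have hκ : ∀ r : N, κ (r : W) = r := fun r => LinearMap.congr_fun hκ₀ r
  -- Projections onto the range and the kernel of `f' p` make `Ψ` a local diffeomorphism at `p`, as
  -- in the constant rank theorem.
  let Ψ : W → R × N := fun q => (π (f q), κ q)
  let Ψ' : W → W →L[ℝ] R × N := fun q => (π.comp (f' q)).prod κ
  have hΨ : ∀ q, HasFDerivAt Ψ (Ψ' q) q := fun q =>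
    (π.hasFDerivAt.comp q (hf q)).prodMk κ.hasFDerivAt
  have hΨc : ContDiff ℝ 1 Ψ := (π.contDiff.comp hc).prodMk κ.contDiff
  have hΨinj : Function.Injective (Ψ' p) := by
    rw [injective_iff_map_eq_zero]
    intro x hx
    have h1 : π (f' p x) = 0 := congrArg Prod.fst hx
    have h2 : κ x = 0 := congrArg Prod.snd hx
    have h3 : f' p x = 0 := by
      have := hπ ⟨f' p x, x, rfl⟩
      simpa [h1] using (congrArg Subtype.val this).symm
    have := hκ ⟨x, h3⟩
    simpa [h2] using (congrArg Subtype.val this).symm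
  have hdim : Module.finrank ℝ W = Module.finrank ℝ (R × N) := by
    rw [Module.finrank_prod, hR, hN, LinearMap.finrank_range_add_finrank_ker]
  let e : W ≃L[ℝ] R × N := (LinearEquiv.ofInjectiveOfFinrankEq (Ψ' p : W →ₗ[ℝ] R × N) hΨinj
    hdim).toContinuousLinearEquiv
  have he : (e : W →L[ℝ] R × N) = Ψ' p := by
    ext x <;> rfl
  have hΨp : HasFDerivAt Ψ (e : W →L[ℝ] R × N) p := he ▸ hΨ p
  have hcp : ContDiffAt ℝ 1 Ψ p := hΨc.contDiffAt
  have hst : HasStrictFDerivAt Ψ (e : W →L[ℝ] R × N) p := hcp.hasStrictFDerivAt' hΨp one_ne_zero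
  let g : R × N → W := hcp.localInverse hΨp one_ne_zero
  have hg : ContDiffAt ℝ 1 g (Ψ p) := hcp.to_localInverse hΨp one_ne_zero
  have hgp : g (Ψ p) = p := hcp.localInverse_apply_image hΨp one_ne_zero
  have hgr : ∀ᶠ y in 𝓝 (Ψ p), Ψ (g y) = y := hst.eventually_right_inverse
  -- The line moves only in the kernel coordinate, so `π ∘ f` is constant along its preimage `γ`
  -- near `0`.
  let c : ℝ → R × N := fun t => Ψ p + t • ((0 : R), (⟨v, hvN⟩ : N))
  have hcd : ContDiff ℝ 1 c := contDiff_const.add (contDiff_id.smul contDiff_const)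
  have hc0 : c 0 = Ψ p := by simp [c]
  have hct : Tendsto c (𝓝 0) (𝓝 (Ψ p)) := hc0 ▸ hcd.continuous.tendsto 0
  let γ : ℝ → W := g ∘ c
  have hγ0 : γ 0 = p := by simp [γ, hc0, hgp]
  have hγd : ContDiffAt ℝ 1 γ 0 := ContDiffAt.comp 0 (hc0.symm ▸ hg) hcd.contDiffAt
  have hγt : Tendsto γ (𝓝 0) (𝓝 p) := hγ0 ▸ hγd.continuousAt
  -- Invertible operators form an open set, so `Ψ' q` stays invertible near `p`.
  have hsurj : ∀ᶠ q in 𝓝 p, Function.Surjective (π.comp (f' q)) := by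
    have hcont : Continuous Ψ' := by
      have : Ψ' = fderiv ℝ Ψ := funext fun q => (hΨ q).fderiv.symm
      rw [this]
      exact hΨc.continuous_fderiv one_ne_zero
    have h1 := hcont.tendsto p (he ▸ e.nhds)
    filter_upwards [h1] with q hq
    obtain ⟨e', he'⟩ := hq
    intro r
    obtain ⟨x, hx⟩ := e'.surjective (r, 0)
    refine ⟨x, ?_⟩
    have : Ψ' q x = (r, 0) := by rw [← he', ← hx]; rfl
    exact congrArg Prod.fst this
  have hev : ∀ᶠ t in 𝓝 (0 : ℝ), DifferentiableAt ℝ γ t ∧ Ψ (γ t) = c t ∧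
      Function.Surjective (π.comp (f' (γ t))) :=
    ((hγd.eventually (by simp)).mono fun t ht => ht.differentiableAt one_ne_zero).and
      ((hct.eventually hgr).and (hγt.eventually hsurj))
  obtain ⟨δ, hδ, hball⟩ := Metric.eventually_nhds_iff_ball.1 (hev.and (hγt.eventually hiso))
  have hderiv : ∀ t ∈ Metric.ball (0 : ℝ) δ, HasDerivAt (f ∘ γ) 0 t := by
    intro t ht
    obtain ⟨⟨hd, -, hs⟩, -⟩ := hball t ht
    have h1 : HasDerivAt (f ∘ γ) (f' (γ t) (deriv γ t)) t :=
      (hf (γ t)).comp_hasDerivAt t hd.hasDerivAt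
    have h2 : HasDerivAt (fun s => π ((f ∘ γ) s)) (π (f' (γ t) (deriv γ t))) t :=
      π.hasFDerivAt.comp_hasDerivAt t h1
    have h3 : HasDerivAt (fun s => π ((f ∘ γ) s)) 0 t := by
      refine (hasDerivAt_const t (π (f p))).congr_of_eventuallyEq ?_
      filter_upwards [Metric.isOpen_ball.mem_nhds ht] with s hs
      have := congrArg Prod.fst (hball s hs).1.2.1
      simpa [Ψ, c] using this
    have h4 : π (f' (γ t) (deriv γ t)) = 0 := h2.unique h3
    -- Here maximality of the rank enters: `π` is injective on the range of `f' (γ t)`, so not only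
    -- `π ∘ f` but `f` itself has zero derivative along `γ`.
    have h5 : f' (γ t) (deriv γ t) = 0 :=
      eq_zero_of_comp_surjective (A := (f' (γ t) : W →ₗ[ℝ] Y)) (π := (π : Y →ₗ[ℝ] R)) hs
        (hrank _) h4
    rwa [h5] at h1
  have hconst : ∀ t ∈ Metric.ball (0 : ℝ) δ, f (γ t) = f p := by
    intro t ht
    have := Metric.isOpen_ball.is_const_of_deriv_eq_zero (convex_ball (0 : ℝ) δ).isPreconnected
      (f := f ∘ γ) (fun s hs => (hderiv s hs).differentiableAt.differentiableWithinAt)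
      (fun s hs => (hderiv s hs).deriv) ht (Metric.mem_ball_self hδ)
    simpa [hγ0] using this
  have hmem : δ / 2 ∈ Metric.ball (0 : ℝ) δ := by
    rw [Metric.mem_ball, Real.dist_eq, sub_zero, abs_of_pos (by positivity)]
    linarith
  obtain ⟨⟨-, hΨc', -⟩, h⟩ := hball _ hmem
  have h6 := h (hconst _ hmem)
  rw [h6] at hΨc'
  have h7 := congrArg Prod.snd hΨc'
  simp only [c, Prod.snd_add, Prod.smul_snd, left_eq_add, smul_eq_zero] at h7
  rcases h7 with h7 | h7
  · linarith
  · exact hv0 (congrArg Subtype.val h7)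

/-! ### Independent representatives and generic independence -/

/-- Rado's theorem for subspaces: if every subfamily of a finite family of subspaces spans a space
of dimension at least its size, then the family has linearly independent representatives. -/
theorem exists_linearIndependent_of_card_le_finrank {K ι M : Type*} [Field K] [Fintype ι]
    [AddCommGroup M] [Module K M] [FiniteDimensional K M] (A : ι → Submodule K M)
    (hA : ∀ X : Finset ι, X.card ≤ Module.finrank K (X.sup A : Submodule K M)) :
    ∃ x : ι → M, (∀ i, x i ∈ A i) ∧ LinearIndependent K x := by
  classical
  induction h : ∑ i, Module.finrank K (A i) using Nat.strong_induction_on generalizing A with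
  | _ n ih =>
  by_cases hone : ∀ i, Module.finrank K (A i) ≤ 1
  · have hx : ∀ i, ∃ x ∈ A i, A i ≤ Submodule.span K {x} := by
      intro i
      obtain ⟨x, hx⟩ := finrank_le_one_iff.1 (hone i)
      refine ⟨x, x.2, fun y hy => ?_⟩
      obtain ⟨c, hc⟩ := hx ⟨y, hy⟩
      exact Submodule.mem_span_singleton.2 ⟨c, congrArg Subtype.val hc⟩
    choose x hxA hxs using hx
    refine ⟨x, hxA, ?_⟩
    rw [linearIndependent_iff_card_le_finrank_span]
    refine (hA Finset.univ).trans (Submodule.finrank_mono ?_)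
    refine Finset.sup_le fun i _ => (hxs i).trans (Submodule.span_mono ?_)
    simp
  · push Not at hone
    obtain ⟨i, hi⟩ := hone
    -- A line in `A i` and the trace on `A i` of a complement of that line; the modular law gives
    -- their sum.
    obtain ⟨B, C, hBC, hB, hC⟩ : ∃ B C : Submodule K M, B ⊔ C = A i ∧ B < A i ∧ C < A i := by
      obtain ⟨x, hx, hx0⟩ : ∃ x ∈ A i, x ≠ 0 := by
        by_contra! hcon
        rw [(Submodule.eq_bot_iff _).2 hcon, finrank_bot] at hi
        omega
      have hspan : Submodule.span K {x} ≤ A i := by simpa using hx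
      have hlt : Submodule.span K {x} < A i := by
        refine lt_of_le_of_ne hspan fun heq => ?_
        rw [← heq, finrank_span_singleton hx0] at hi
        omega
      obtain ⟨D, hD⟩ := Submodule.exists_isCompl (Submodule.span K {x})
      refine ⟨Submodule.span K {x}, D ⊓ A i, ?_, hlt, ?_⟩
      · rw [← sup_inf_assoc_of_le _ hspan, hD.sup_eq_top, top_inf_eq]
      · refine lt_of_le_of_ne inf_le_right fun heq => hx0 ?_
        have : x ∈ D := (heq.symm ▸ hx : x ∈ D ⊓ A i).1
        exact (Submodule.mem_bot K).1 (hD.inf_eq_bot ▸ ⟨Submodule.mem_span_singleton_self x, this⟩)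
    have key : ∀ D : Submodule K M, D < A i →
        (∀ X : Finset ι, i ∉ X → X.card + 1 ≤ Module.finrank K (D ⊔ X.sup A : Submodule K M)) →
        ∃ x : ι → M, (∀ i, x i ∈ A i) ∧ LinearIndependent K x := by
      intro D hD hX
      obtain ⟨x, hx, hxi⟩ := ih (∑ j, Module.finrank K (Function.update A i D j)) (by
          rw [← h]
          refine Finset.sum_lt_sum (fun j _ => ?_) ⟨i, Finset.mem_univ _, ?_⟩
          · rcases eq_or_ne j i with rfl | hj
            · rw [Function.update_self]
              exact Submodule.finrank_mono hD.le
            · rw [Function.update_of_ne hj]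
          · rw [Function.update_self]
            exact Submodule.finrank_lt_finrank_of_lt hD) (Function.update A i D) (by
          intro X
          have hcongr : ∀ Y : Finset ι, i ∉ Y → Y.sup (Function.update A i D) = Y.sup A :=
            fun Y hY => Finset.sup_congr rfl fun j hj => by
              rw [Function.update_of_ne]
              rintro rfl
              exact hY hj
          by_cases hiX : i ∈ X
          · rw [← Finset.insert_erase hiX, Finset.sup_insert, Function.update_self,
              hcongr _ (Finset.notMem_erase i X), Finset.card_insert_of_notMem
              (Finset.notMem_erase i X)]
            exact hX _ (Finset.notMem_erase i X)
          · rw [hcongr X hiX]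
            exact hA X) rfl
      refine ⟨x, fun j => ?_, hxi⟩
      rcases eq_or_ne j i with rfl | hj
      · exact hD.le (by simpa using hx j)
      · simpa [hj] using hx j
    -- If replacing `A i` by `B` violates the condition at `X`, and replacing it by `C` violates it
    -- at `Y`, then the sum and the intersection of the two violating spaces have total dimension at
    -- most `|X| + |Y|`. The condition for `insert i (X ∪ Y)` and `X ∩ Y` demands one more.
    by_contra hno
    have hB' := mt (key B hB) hno
    have hC' := mt (key C hC) hno
    push Not at hB' hC'
    obtain ⟨X, hiX, hX⟩ := hB'
    obtain ⟨Y, hiY, hY⟩ := hC'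
    have hdim := Submodule.finrank_sup_add_finrank_inf_eq (B ⊔ X.sup A) (C ⊔ Y.sup A)
    have h1 : (insert i (X ∪ Y)).card ≤
        Module.finrank K ((B ⊔ X.sup A) ⊔ (C ⊔ Y.sup A) : Submodule K M) := by
      refine (hA _).trans (Submodule.finrank_mono ?_)
      rw [Finset.sup_insert, Finset.sup_union, ← hBC]
      refine sup_le (sup_le ?_ ?_) (sup_le ?_ ?_)
      · exact le_sup_left.trans le_sup_left
      · exact le_sup_left.trans le_sup_right
      · exact le_sup_right.trans le_sup_left
      · exact le_sup_right.trans le_sup_right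
    have h2 : (X ∩ Y).card ≤
        Module.finrank K ((B ⊔ X.sup A) ⊓ (C ⊔ Y.sup A) : Submodule K M) := by
      refine (hA _).trans (Submodule.finrank_mono (le_inf ?_ ?_))
      · exact (Finset.sup_mono Finset.inter_subset_left).trans le_sup_right
      · exact (Finset.sup_mono Finset.inter_subset_right).trans le_sup_right
    rw [Finset.card_insert_of_notMem (by simp [hiX, hiY])] at h1
    have := Finset.card_union_add_card_inter X Y
    omega

/-- Linearly independent functionals take arbitrary prescribed values. -/
theorem surjective_pi_of_linearIndependent {K ι M : Type*} [Field K] [Finite ι] [AddCommGroup M]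
    [Module K M] {φ : ι → Module.Dual K M} (hφ : LinearIndependent K φ) :
    Function.Surjective (LinearMap.pi φ) := by
  classical
  have := Fintype.ofFinite ι
  rw [← LinearMap.range_eq_top]
  by_contra hne
  obtain ⟨f, hf0, hf⟩ := Submodule.exists_le_ker_of_lt_top _ (lt_top_iff_ne_top.2 hne)
  refine hf0 (LinearMap.pi_ext' fun r => LinearMap.ext_ring ?_)
  -- A functional vanishing on the range is a linear relation among the `φ r`.
  have hzero : ∑ r, f (Pi.single r 1) • φ r = 0 := by
    ext y
    have h1 : f (LinearMap.pi φ y) = 0 := hf ⟨y, rfl⟩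
    have hs : ∀ r : ι, (Pi.single r 1 : ι → K) = fun j => if r = j then 1 else 0 :=
      fun r => funext fun j => by simp [Pi.single_apply, eq_comm]
    rw [LinearMap.pi_apply_eq_sum_univ f] at h1
    simpa [mul_comm, hs] using h1
  simpa using Fintype.linearIndependent_iff.1 hφ _ hzero r

/-- Finitely many families of functionals that depend polynomially on a parameter, and each of which
is linearly independent for some parameter, are linearly independent for a common parameter. -/
theorem exists_forall_linearIndependent {K σ α M : Type*} {R : α → Type*} [Field K] [Infinite K]
    [Finite α] [∀ a, Finite (R a)] [AddCommGroup M] [Module K M] [FiniteDimensional K M]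
    (φ : ∀ a, R a → (σ → K) → Module.Dual K M)
    (hpoly : ∀ a r x, ∃ P : MvPolynomial σ K, ∀ d, MvPolynomial.eval d P = φ a r d x)
    (hex : ∀ a, ∃ d, LinearIndependent K fun r => φ a r d) :
    ∃ d, ∀ a, LinearIndependent K fun r => φ a r d := by
  classical
  have := Fintype.ofFinite α
  have := fun a => Fintype.ofFinite (R a)
  choose P hP using hpoly
  have hQ : ∀ a, ∃ Q : MvPolynomial σ K, Q ≠ 0 ∧
      ∀ d, MvPolynomial.eval d Q ≠ 0 → LinearIndependent K fun r => φ a r d := by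
    intro a
    obtain ⟨d₀, hd₀⟩ := hex a
    -- Vectors dual to the family at `d₀`: the determinant of the values on them is a polynomial in
    -- the parameter equal to `1` at `d₀`, and it certifies independence wherever it is nonzero.
    obtain ⟨x, hx⟩ : ∃ x : R a → M, ∀ r s, φ a r d₀ (x s) = if s = r then 1 else 0 := by
      have hsurj := surjective_pi_of_linearIndependent hd₀
      choose x hx using fun s => hsurj (Pi.single s (1 : K))
      refine ⟨x, fun r s => ?_⟩
      simpa [Pi.single_apply, eq_comm] using congrFun (hx s) r
    refine ⟨Matrix.det (Matrix.of fun r s => P a r (x s)), ?_, ?_⟩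
    · intro h0
      have h1 := congrArg (MvPolynomial.eval d₀) h0
      rw [RingHom.map_det, map_zero] at h1
      have h2 : (MvPolynomial.eval d₀).mapMatrix (Matrix.of fun r s => P a r (x s)) = 1 := by
        ext r s
        simp [hP, hx, Matrix.one_apply, eq_comm]
      rw [h2, Matrix.det_one] at h1
      exact one_ne_zero h1
    · intro d hd
      rw [RingHom.map_det] at hd
      rw [Fintype.linearIndependent_iff]
      intro c hc
      have h1 : Matrix.vecMul c
          ((MvPolynomial.eval d).mapMatrix (Matrix.of fun r s => P a r (x s))) = 0 := by
        ext s
        have := LinearMap.congr_fun hc (x s)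
        simpa [Matrix.vecMul, dotProduct, hP] using this
      exact congrFun (Matrix.eq_zero_of_vecMul_eq_zero hd h1)
  choose Q hQ0 hQ using hQ
  have hprod : ∏ a, Q a ≠ 0 := Finset.prod_ne_zero_iff.2 fun a _ => hQ0 a
  obtain ⟨d, hd⟩ : ∃ d, MvPolynomial.eval d (∏ a, Q a) ≠ 0 := by
    by_contra! h
    exact hprod (MvPolynomial.funext fun d => by simpa using h d)
  rw [map_prod] at hd
  exact ⟨d, fun a => hQ a d (Finset.prod_ne_zero_iff.1 hd a (Finset.mem_univ a))⟩

/-! ### Frames: rows with freely chosen vectors -/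

namespace LoopedGraph

variable {V E L : Type*}

/-- One end of an edge. -/
noncomputable def src (G : LoopedGraph V E L) (e : E) : V := (Quot.out (G.ends e)).1

/-- The other end of an edge. -/
noncomputable def tgt (G : LoopedGraph V E L) (e : E) : V := (Quot.out (G.ends e)).2

theorem ends_eq (G : LoopedGraph V E L) (e : E) : G.ends e = s(G.src e, G.tgt e) :=
  (Quot.out_eq (G.ends e)).symm

theorem src_ne_tgt (G : LoopedGraph V E L) (e : E) : G.src e ≠ G.tgt e := by
  have := G.ends_not_isDiag e
  rwa [G.ends_eq, Sym2.mk_isDiag_iff] at this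

theorem mem_inducedEdges (G : LoopedGraph V E L) (S : Finset V) (e : E) :
    e ∈ G.inducedEdges S ↔ G.src e ∈ S ∧ G.tgt e ∈ S := by
  simp [inducedEdges, G.ends_eq]

/-- The difference of the positions of the ends of an edge, and the position of the base of a
loop. -/
noncomputable def displacement (G : LoopedGraph V E L) : E ⊕ L → (V → Plane) →ₗ[ℝ] Plane :=
  Sum.elim (fun e => LinearMap.proj (R := ℝ) (φ := fun _ : V => Plane) (G.src e) -
      LinearMap.proj (R := ℝ) (φ := fun _ : V => Plane) (G.tgt e))
    fun l => LinearMap.proj (R := ℝ) (φ := fun _ : V => Plane) (G.base l)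

@[simp]
theorem displacement_inl (G : LoopedGraph V E L) (e : E) (x : V → Plane) :
    G.displacement (Sum.inl e) x = x (G.src e) - x (G.tgt e) := rfl

@[simp]
theorem displacement_inr (G : LoopedGraph V E L) (l : L) (x : V → Plane) :
    G.displacement (Sum.inr l) x = x (G.base l) := rfl

/-- The inner product of a vector with the displacement of an edge or a loop. -/
noncomputable def frameForm (G : LoopedGraph V E L) (r : E ⊕ L) :
    Plane →ₗ[ℝ] Module.Dual ℝ (V → Plane) :=
  (G.displacement r).dualMap ∘ₗ innerₗ Plane

@[simp]
theorem frameForm_apply (G : LoopedGraph V E L) (r : E ⊕ L) (d : Plane) (x : V → Plane) :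
    G.frameForm r d x = inner ℝ d (G.displacement r x) := rfl

/-- Pairing the displacement with itself shows that the functionals of one row, for all vectors,
vanish together only where the displacement does. -/
theorem mem_dualCoannihilator_sup_range_frameForm (G : LoopedGraph V E L) (X : Finset (E ⊕ L))
    (x : V → Plane) :
    x ∈ (X.sup fun r => LinearMap.range (G.frameForm r)).dualCoannihilator ↔
      ∀ r ∈ X, G.displacement r x = 0 := by
  rw [Submodule.mem_dualCoannihilator]
  constructor
  · intro h r hr
    have := h (G.frameForm r (G.displacement r x))
      (Finset.le_sup (f := fun r => LinearMap.range (G.frameForm r)) hr ⟨_, rfl⟩)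
    simpa using this
  · intro h
    have : (X.sup fun r => LinearMap.range (G.frameForm r)) ≤
        LinearMap.ker (Module.Dual.eval ℝ (V → Plane) x) := by
      refine Finset.sup_le fun r hr => ?_
      rintro _ ⟨d, rfl⟩
      simp [h r hr]
    exact fun φ hφ => this hφ

/-- If edges are `(2,2)`-sparse and edges and loops together are `(2,0)`-sparse, then the
configurations in which the edges in `X` are collapsed and the loops in `X` are at the origin form
a space of codimension at least the size of `X`. -/
theorem card_le_finrank_sup_range_frameForm [Fintype V] [Finite E] [Finite L]
    (G : LoopedGraph V E L)
    (hE : ∀ S : Finset V, S.Nonempty → (G.inducedEdges S).ncard + 2 ≤ 2 * S.card)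
    (hT : ∀ S : Finset V, (G.inducedEdges S).ncard + (G.inducedLoops S).ncard ≤ 2 * S.card)
    (X : Finset (E ⊕ L)) :
    X.card ≤ Module.finrank ℝ
      (X.sup fun r => LinearMap.range (G.frameForm r) : Submodule ℝ (Module.Dual ℝ (V → Plane))) := by
  classical
  set A := X.sup fun r => LinearMap.range (G.frameForm r) with hA
  -- The classes are the connected components of the edges in `X`.
  let s : Setoid V := Relation.EqvGen.setoid fun a b => ∃ e, Sum.inl e ∈ X ∧ a = G.src e ∧ b = G.tgt e
  let cls : E ⊕ L → Quotient s := Sum.elim (fun e => ⟦G.src e⟧) fun l => ⟦G.base l⟧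
  have htgt : ∀ e, Sum.inl e ∈ X → (⟦G.tgt e⟧ : Quotient s) = ⟦G.src e⟧ := fun e he =>
    (Quotient.sound (Relation.EqvGen.rel _ _ ⟨e, he, rfl, rfl⟩)).symm
  let free : Quotient s → Prop := fun c => ∀ l, Sum.inr l ∈ X → (⟦G.base l⟧ : Quotient s) ≠ c
  -- A collapsed configuration is constant on components and zero on those with a loop of `X`, so it
  -- is determined by one point for each free component.
  have hker : Module.finrank ℝ A.dualCoannihilator ≤ 2 * Fintype.card {c // free c} := by
    let T : A.dualCoannihilator →ₗ[ℝ] ({c // free c} → Plane) :=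
      (LinearMap.pi fun c => LinearMap.proj (Quotient.out c.1)) ∘ₗ A.dualCoannihilator.subtype
    have hT : Function.Injective T := by
      rw [injective_iff_map_eq_zero]
      rintro ⟨x, hx⟩ h0
      rw [hA, mem_dualCoannihilator_sup_range_frameForm] at hx
      have hclass : ∀ a b, s a b → x a = x b := by
        intro a b hab
        induction hab with
        | rel a b h =>
          obtain ⟨e, he, rfl, rfl⟩ := h
          exact sub_eq_zero.1 (hx _ he)
        | refl a => rfl
        | symm a b _ h => exact h.symm
        | trans a b c _ _ h₁ h₂ => exact h₁.trans h₂
      ext1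
      funext v
      by_cases hv : free ⟦v⟧
      · change x v = 0
        have h1 : x (Quotient.out (⟦v⟧ : Quotient s)) = 0 := congrFun h0 ⟨⟦v⟧, hv⟩
        rw [← hclass _ _ (Quotient.mk_out v)]
        exact h1
      · simp only [free] at hv
        push Not at hv
        obtain ⟨l, hl, hlv⟩ := hv
        change x v = 0
        rw [← hclass _ _ (Quotient.exact hlv)]
        exact hx _ hl
    calc Module.finrank ℝ A.dualCoannihilator
        ≤ Module.finrank ℝ ({c // free c} → Plane) := LinearMap.finrank_le_finrank_of_injective hT
      _ = 2 * Fintype.card {c // free c} := by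
        rw [Module.finrank_pi_fintype]
        simp [mul_comm]
  -- A free component contains only edges of `X`, so the edge bound leaves room for the two degrees
  -- of freedom of its common point; any other component uses the joint bound. Summing over
  -- components gives the codimension.
  have hfib : ∀ c : Quotient s, (X.filter fun r => cls r = c).card + (if free c then 2 else 0) ≤
      2 * (Finset.univ.filter fun v : V => (⟦v⟧ : Quotient s) = c).card := by
    intro c
    set S := Finset.univ.filter fun v : V => (⟦v⟧ : Quotient s) = c with hS
    have hmemE : ∀ e, Sum.inl e ∈ X → cls (Sum.inl e) = c → e ∈ G.inducedEdges S := by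
      intro e he hc
      rw [mem_inducedEdges]
      simp only [hS, Finset.mem_filter, Finset.mem_univ, true_and]
      exact ⟨hc, (htgt e he).trans hc⟩
    have hmemL : ∀ l, cls (Sum.inr l) = c → l ∈ G.inducedLoops S := by
      intro l hc
      simp only [inducedLoops, hS, Finset.mem_filter, Finset.mem_univ, true_and]
      exact hc
    rw [← Set.ncard_coe_finset]
    split_ifs with hc
    · have hne : S.Nonempty := by
        induction c using Quotient.inductionOn with
        | _ v => exact ⟨v, by simp [hS]⟩
      refine le_trans ?_ (hE S hne)
      rw [← Set.ncard_image_of_injective (G.inducedEdges S) (Sum.inl_injective (β := L))]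
      refine Nat.add_le_add_right (Set.ncard_le_ncard ?_ (Set.toFinite _)) 2
      rintro (e | l) hr
      · simp only [Finset.coe_filter, Set.mem_ofPred_eq] at hr
        exact ⟨e, hmemE e hr.1 hr.2, rfl⟩
      · simp only [Finset.coe_filter, Set.mem_ofPred_eq] at hr
        exact absurd hr.2 (hc l hr.1)
    · refine le_trans ?_ (hT S)
      rw [← Set.ncard_image_of_injective (G.inducedEdges S) (Sum.inl_injective (β := L)),
        ← Set.ncard_image_of_injective (G.inducedLoops S) (Sum.inr_injective (α := E)), add_zero]
      refine (Set.ncard_le_ncard ?_ (Set.toFinite _)).trans (Set.ncard_union_le _ _)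
      rintro (e | l) hr
      · simp only [Finset.coe_filter, Set.mem_ofPred_eq] at hr
        exact Or.inl ⟨e, hmemE e hr.1 hr.2, rfl⟩
      · simp only [Finset.coe_filter, Set.mem_ofPred_eq] at hr
        exact Or.inr ⟨l, hmemL l hr.2, rfl⟩
  have hX : X.card = ∑ c, (X.filter fun r => cls r = c).card :=
    Finset.card_eq_sum_card_fiberwise fun _ _ => Finset.mem_univ _
  have hV : Fintype.card V = ∑ c : Quotient s,
      (Finset.univ.filter fun v : V => (⟦v⟧ : Quotient s) = c).card :=
    Finset.card_eq_sum_card_fiberwise fun _ _ => Finset.mem_univ _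
  have hfree : 2 * Fintype.card {c // free c} = ∑ c, if free c then 2 else 0 := by
    rw [Fintype.card_subtype, ← Finset.sum_filter, Finset.sum_const, smul_eq_mul, mul_comm]
  have hsum := Finset.sum_le_sum fun c (_ : c ∈ Finset.univ) => hfib c
  rw [Finset.sum_add_distrib, ← hX, ← hfree, ← Finset.mul_sum, ← hV] at hsum
  have hdim := Subspace.finrank_add_finrank_dualCoannihilator_eq A
  rw [Module.finrank_pi_fintype] at hdim
  simp only [finrank_euclideanSpace, Fintype.card_fin, Finset.sum_const, Finset.card_univ,
    smul_eq_mul] at hdim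
  omega

/-- Generic frames of sparse looped graphs are independent. -/
theorem exists_linearIndependent_frameForm [Fintype V] [Finite E] [Finite L]
    (G : LoopedGraph V E L)
    (hE : ∀ S : Finset V, S.Nonempty → (G.inducedEdges S).ncard + 2 ≤ 2 * S.card)
    (hT : ∀ S : Finset V, (G.inducedEdges S).ncard + (G.inducedLoops S).ncard ≤ 2 * S.card) :
    ∃ d : E ⊕ L → Plane, LinearIndependent ℝ fun r => G.frameForm r (d r) := by
  have := Fintype.ofFinite E
  have := Fintype.ofFinite L
  obtain ⟨φ, hφ, hli⟩ := exists_linearIndependent_of_card_le_finrank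
    (fun r => LinearMap.range (G.frameForm r)) (G.card_le_finrank_sup_range_frameForm hE hT)
  choose d hd using hφ
  exact ⟨d, by simpa only [hd] using hli⟩

/-- The edges of a looped graph together with a parallel copy of one of them, without the loops. -/
def parallelEdge (G : LoopedGraph V E L) (e : E) (L' : Type*) [IsEmpty L'] :
    LoopedGraph V (Option E) L' where
  ends o := G.ends (o.getD e)
  ends_not_isDiag o := G.ends_not_isDiag (o.getD e)
  base := isEmptyElim

theorem IsGradedSparse.inducedEdges_ncard_le {G : LoopedGraph V E L}
    (hG : G.IsGradedSparse) (S : Finset V) :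
    G.inducedEdges S = ∅ ∨ (G.inducedEdges S).ncard + 3 ≤ 2 * S.card := by
  rcases Nat.lt_or_ge S.card 2 with h | h
  · left
    have h1 : S.card ≤ 1 := by omega
    rw [Finset.card_le_one] at h1
    refine Set.eq_empty_iff_forall_notMem.2 fun e he => ?_
    rw [mem_inducedEdges] at he
    exact G.src_ne_tgt e (h1 _ he.1 _ he.2)
  · exact Or.inr (hG.edges_sparse S h)

theorem IsGradedSparse.edges_le {G : LoopedGraph V E L}
    (hG : G.IsGradedSparse) {S : Finset V} (hS : S.Nonempty) :
    (G.inducedEdges S).ncard + 2 ≤ 2 * S.card := by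
  have := hS.card_pos
  rcases hG.inducedEdges_ncard_le S with h | h
  · rw [h, Set.ncard_empty]
    omega
  · omega

/-- The extra copy uses up one of the three units of slack in the edge bound, and frames need only
two. This is where `2n' - 3` is needed rather than `2n' - 2`. -/
theorem IsGradedSparse.parallelEdge_edges_le [Finite E] {G : LoopedGraph V E L}
    (hG : G.IsGradedSparse) (e : E) (L' : Type*) [IsEmpty L'] {S : Finset V} (hS : S.Nonempty) :
    ((G.parallelEdge e L').inducedEdges S).ncard + 2 ≤ 2 * S.card := by
  have hsub : (G.parallelEdge e L').inducedEdges S ⊆ {o | o.getD e ∈ G.inducedEdges S} :=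
    fun _ ho => ho
  have := hS.card_pos
  rcases hG.inducedEdges_ncard_le S with h | h
  · rw [h] at hsub
    rw [Set.eq_empty_of_subset_empty hsub, Set.ncard_empty]
    omega
  · have h1 : {o : Option E | o.getD e ∈ G.inducedEdges S} ⊆
        insert none (some '' G.inducedEdges S) := by
      rintro (_ | o) ho
      · exact Set.mem_insert _ _
      · exact Set.mem_insert_of_mem _ ⟨o, ho, rfl⟩
    have h2 := Set.ncard_le_ncard (hsub.trans h1) (Set.toFinite _)
    have h3 := Set.ncard_insert_le (none : Option E) (some '' G.inducedEdges S)
    have h4 := Set.ncard_image_of_injective (G.inducedEdges S) (Option.some_injective E)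
    omega

end LoopedGraph

/-! ### The quarter turn -/

/-- The quarter turn of the plane. -/
noncomputable def quarterTurn : Plane →ₗ[ℝ] Plane where
  toFun x := !₂[-x 1, x 0]
  map_add' x y := by ext i; fin_cases i <;> simp [add_comm]
  map_smul' c x := by ext i; fin_cases i <;> simp

@[simp]
theorem quarterTurn_apply_zero (x : Plane) : quarterTurn x 0 = -x 1 := rfl

@[simp]
theorem quarterTurn_apply_one (x : Plane) : quarterTurn x 1 = x 0 := rfl

@[simp]
theorem quarterTurn_quarterTurn (x : Plane) : quarterTurn (quarterTurn x) = -x := by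
  ext i; fin_cases i <;> simp

theorem plane_inner_eq (x y : Plane) : inner ℝ x y = x 0 * y 0 + x 1 * y 1 := by
  simp [PiLp.inner_apply, Fin.sum_univ_two, mul_comm]

theorem inner_quarterTurn_left (x y : Plane) :
    inner ℝ (quarterTurn x) y = inner ℝ x (-quarterTurn y) := by
  simp only [plane_inner_eq, quarterTurn_apply_zero, quarterTurn_apply_one, PiLp.neg_apply]
  ring

theorem inner_quarterTurn_self (x : Plane) : inner ℝ x (quarterTurn x) = 0 := by
  simp only [plane_inner_eq, quarterTurn_apply_zero, quarterTurn_apply_one]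
  ring

/-- The coefficient is the inner product of `w` with the quarter turn of `d`, divided by the squared
length of `d`. -/
theorem exists_smul_quarterTurn_of_inner_eq_zero {d w : Plane} (hd : d ≠ 0)
    (h : inner ℝ d w = 0) : ∃ a : ℝ, w = a • quarterTurn d := by
  rw [plane_inner_eq] at h
  have hd' : d 0 ^ 2 + d 1 ^ 2 ≠ 0 := by
    intro h0
    refine hd ?_
    ext i
    fin_cases i
    · simpa using (by nlinarith [sq_nonneg (d 0), sq_nonneg (d 1)] : d 0 ^ 2 = 0)
    · simpa using (by nlinarith [sq_nonneg (d 0), sq_nonneg (d 1)] : d 1 ^ 2 = 0)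
  refine ⟨(d 0 * w 1 - d 1 * w 0) / (d 0 ^ 2 + d 1 ^ 2), ?_⟩
  ext i
  fin_cases i
  · simp only [Fin.zero_eta, PiLp.smul_apply, quarterTurn_apply_zero, smul_eq_mul]
    field_simp
    linear_combination d 0 * h
  · simp only [Fin.mk_one, PiLp.smul_apply, quarterTurn_apply_one, smul_eq_mul]
    field_simp
    linear_combination d 1 * h

/-! ### The rigidity map, and independent realizations of sparse graphs -/

namespace LoopedGraph

variable {V E L : Type*}

/-- The vectors of a framework: the displacements of the edges and the normals of the loops. -/
noncomputable def barSliderVector (G : LoopedGraph V E L) (q : V → Plane) (ν : L → Plane) :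
    E ⊕ L → Plane :=
  Sum.elim (fun e => q (G.src e) - q (G.tgt e)) ν

/-- The linear map of the pinned rigidity matrix. -/
noncomputable def rigidityMap (G : LoopedGraph V E L) (q : V → Plane) (ν : L → Plane) :
    (V → Plane) →ₗ[ℝ] (E ⊕ L → ℝ) :=
  LinearMap.pi fun r => G.frameForm r (G.barSliderVector q ν r)

theorem rigidityMap_apply (G : LoopedGraph V E L) (q : V → Plane) (ν : L → Plane) (x : V → Plane)
    (r : E ⊕ L) :
    G.rigidityMap q ν x r = inner ℝ (G.barSliderVector q ν r) (G.displacement r x) := rfl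

theorem rigidityMatrix_rank [Fintype V] [Finite E] [Finite L] (G : LoopedGraph V E L)
    (q : V → Plane) (ν : L → Plane) :
    (G.rigidityMatrix q ν).rank = Module.finrank ℝ (LinearMap.range (G.rigidityMap q ν)) := by
  classical
  let T : (V × Fin 2 → ℝ) ≃ₗ[ℝ] (V → Plane) :=
    (LinearEquiv.curry ℝ ℝ V (Fin 2)).trans
      (LinearEquiv.piCongrRight fun _ => (WithLp.linearEquiv 2 ℝ (Fin 2 → ℝ)).symm)
  have hT : ∀ x v k, T x v k = x (v, k) := fun _ _ _ => rfl
  have hmul : (G.rigidityMatrix q ν).mulVecLin = G.rigidityMap q ν ∘ₗ T.toLinearMap := by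
    refine LinearMap.ext fun x => funext fun r => ?_
    rw [LinearMap.comp_apply, rigidityMap_apply, Matrix.mulVecLin_apply, Matrix.mulVec, dotProduct,
      Fintype.sum_prod_type, plane_inner_eq]
    rcases r with e | l
    · have hne := G.src_ne_tgt e
      have hrow : ∀ v k, G.rigidityMatrix q ν (Sum.inl e) (v, k) =
          (if v = G.src e then q (G.src e) k - q (G.tgt e) k else 0) +
          (if v = G.tgt e then q (G.tgt e) k - q (G.src e) k else 0) := by
        intro v k
        simp only [rigidityMatrix, Matrix.of_apply, G.ends_eq, Sym2.eq_iff]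
        by_cases h1 : v = G.src e
        · subst h1
          simp [hne, hne.symm]
        · by_cases h2 : v = G.tgt e
          · subst h2
            simp [h1, hne]
          · simp [h1, h2, Ne.symm h1, Ne.symm h2]
      simp only [hrow, Fin.sum_univ_two, add_mul, ite_mul, zero_mul, Finset.sum_add_distrib,
        Finset.sum_ite_eq', Finset.mem_univ, if_true, barSliderVector, Sum.elim_inl,
        displacement_inl, PiLp.sub_apply, LinearEquiv.coe_coe, hT]
      ring
    · simp [rigidityMatrix, barSliderVector, hT]
  rw [Matrix.rank, hmul, LinearMap.range_comp, LinearEquiv.range, Submodule.map_top]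

/-- Sparse looped graphs have realizations with independent rows of the pinned rigidity matrix. -/
theorem IsGradedSparse.exists_linearIndependent [Fintype V] [Finite E] [Finite L]
    {G : LoopedGraph V E L} (hG : G.IsGradedSparse) :
    ∃ q ν, LinearIndependent ℝ fun r => G.frameForm r (G.barSliderVector q ν r) := by
  classical
  obtain ⟨d₀, hd₀⟩ := G.exists_linearIndependent_frameForm (fun S hS => hG.edges_le hS) hG.sparse
  -- The empty loop type is a subtype of `L`, so that the row types of these graphs share a universe
  -- with `E ⊕ L` and fit in one family with it.
  have hpar : ∀ e, ∃ d : Option E ⊕ {_l : L // False} → Plane,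
      LinearIndependent ℝ fun r => (G.parallelEdge e {_l : L // False}).frameForm r (d r) := by
    intro e
    refine (G.parallelEdge e {_l : L // False}).exists_linearIndependent_frameForm
      (fun S hS => hG.parallelEdge_edges_le e _ hS) fun S => ?_
    rw [Set.eq_empty_of_isEmpty ((G.parallelEdge e {_l : L // False}).inducedLoops S), Set.ncard_empty,
      add_zero]
    rcases S.eq_empty_or_nonempty with rfl | hS
    · have : (G.parallelEdge e {_l : L // False}).inducedEdges ∅ = ∅ := by
        ext o
        simp [mem_inducedEdges]
      rw [this]
      simp
    · have := hG.parallelEdge_edges_le e {_l : L // False} hS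
      omega
  choose d₁ hd₁ using hpar
  -- Only the edge vectors are parameters, shared by `G` and all graphs with a doubled edge; the
  -- vectors of the loops and of the extra copies stay fixed.
  let vec : (E × Fin 2 → ℝ) → E → Plane := fun d e => !₂[d (e, 0), d (e, 1)]
  have hvec : ∀ d : E → Plane, vec (fun a => d a.1 a.2) = d := by
    intro d
    ext e i
    fin_cases i <;> rfl
  let R : Option E → Type _ := fun a => a.elim (E ⊕ L) fun _ => Option E ⊕ {_l : L // False}
  let φ : ∀ a, R a → (E × Fin 2 → ℝ) → Module.Dual ℝ (V → Plane) := fun a =>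
    match a with
    | none => fun r d => G.frameForm r (Sum.elim (vec d) (fun l => d₀ (Sum.inr l)) r)
    | some e => fun r d => (G.parallelEdge e {_l : L // False}).frameForm r
        (Sum.elim (fun o : Option E => o.elim (d₁ e (Sum.inl none)) (vec d)) isEmptyElim r)
  have hRfin : ∀ a, Finite (R a) := by
    rintro (_ | e)
    · exact inferInstanceAs (Finite (E ⊕ L))
    · exact inferInstanceAs (Finite (Option E ⊕ {_l : L // False}))
  have hlin : ∀ (e : E) (y : Plane), ∃ P : MvPolynomial (E × Fin 2) ℝ,
      ∀ d, MvPolynomial.eval d P = inner ℝ (vec d e) y := fun e y =>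
    ⟨MvPolynomial.X (e, 0) * MvPolynomial.C (y 0) + MvPolynomial.X (e, 1) * MvPolynomial.C (y 1),
      fun d => by simp [plane_inner_eq, vec]⟩
  have hconst : ∀ c : ℝ, ∃ P : MvPolynomial (E × Fin 2) ℝ, ∀ d, MvPolynomial.eval d P = c :=
    fun c => ⟨MvPolynomial.C c, fun d => by simp⟩
  obtain ⟨d, hd⟩ := exists_forall_linearIndependent φ
    (by
      rintro (_ | e) r x
      · rcases r with e | l
        · exact hlin e _
        · exact hconst (G.frameForm (Sum.inr l) (d₀ (Sum.inr l)) x)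
      · rcases r with (_ | e') | l
        · exact hconst ((G.parallelEdge e {_l : L // False}).frameForm (Sum.inl none)
            (d₁ e (Sum.inl none)) x)
        · exact hlin e' _
        · exact l.2.elim)
    (by
      rintro (_ | e)
      · refine ⟨fun a => d₀ (Sum.inl a.1) a.2, ?_⟩
        have heq : (fun r => G.frameForm r (Sum.elim (vec fun a => d₀ (Sum.inl a.1) a.2)
            (fun l => d₀ (Sum.inr l)) r)) = fun r => G.frameForm r (d₀ r) := by
          funext r
          rw [hvec fun e => d₀ (Sum.inl e)]
          rcases r with e | l <;> rfl
        exact heq ▸ hd₀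
      · refine ⟨fun a => d₁ e (Sum.inl (some a.1)) a.2, ?_⟩
        have heq : (fun r => (G.parallelEdge e {_l : L // False}).frameForm r
            (Sum.elim (fun o : Option E => o.elim (d₁ e (Sum.inl none))
              (vec fun a => d₁ e (Sum.inl (some a.1)) a.2)) isEmptyElim r)) =
            fun r => (G.parallelEdge e {_l : L // False}).frameForm r (d₁ e r) := by
          funext r
          rw [hvec fun e' => d₁ e (Sum.inl (some e'))]
          rcases r with (_ | e') | l
          · rfl
          · rfl
          · exact l.2.elim
        exact heq ▸ hd₁ e)
  have hmain : LinearIndependent ℝ fun r => G.frameForm r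
    (Sum.elim (vec d) (fun l => d₀ (Sum.inr l)) r) := hd none
  have hd0 : ∀ e, vec d e ≠ 0 := by
    intro e h0
    refine hmain.ne_zero (Sum.inl e) ?_
    simp [h0]
  -- By independence in the doubled graph, the original edge rows can be made zero while the row of
  -- the extra copy of `e` equals `1`, so `e` is not collapsed.
  have hsep : ∀ e, ∃ x : V → Plane, (∀ e', inner ℝ (vec d e') (x (G.src e') - x (G.tgt e')) = 0) ∧
      x (G.src e) ≠ x (G.tgt e) := by
    intro e
    have hli : LinearIndependent ℝ fun r : Option E ⊕ {_l : L // False} =>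
        (G.parallelEdge e {_l : L // False}).frameForm r
          (Sum.elim (fun o : Option E => o.elim (d₁ e (Sum.inl none)) (vec d)) isEmptyElim r) :=
      hd (some e)
    obtain ⟨x, hx⟩ := surjective_pi_of_linearIndependent hli (Pi.single (Sum.inl none) 1)
    refine ⟨x, fun e' => ?_, fun h => ?_⟩
    · exact (congrFun hx (Sum.inl (some e'))).trans (by simp)
    · have h1 : inner ℝ (d₁ e (Sum.inl none)) (x (G.src e) - x (G.tgt e)) = 1 :=
        (congrFun hx (Sum.inl none)).trans (by simp)
      simp [h] at h1
  -- A real vector space is not a finite union of proper subspaces, so one solution avoids all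
  -- collapses at once.
  obtain ⟨q, hq, hqe⟩ : ∃ q : V → Plane,
      (∀ e, inner ℝ (vec d e) (q (G.src e) - q (G.tgt e)) = 0) ∧ ∀ e, q (G.src e) ≠ q (G.tgt e) := by
    have := Fintype.ofFinite E
    let K : Submodule ℝ (V → Plane) := LinearMap.ker
      (LinearMap.pi fun e => G.frameForm (Sum.inl e) (vec d e))
    have hK : ∀ x, x ∈ K ↔ ∀ e, inner ℝ (vec d e) (x (G.src e) - x (G.tgt e)) = 0 :=
      fun x => LinearMap.mem_ker.trans funext_iff
    let C : E → Submodule ℝ K := fun e => LinearMap.ker (G.displacement (Sum.inl e) ∘ₗ K.subtype)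
    have hC : ⊤ ∉ Finset.univ.image C := by
      simp only [Finset.mem_image, Finset.mem_univ, true_and, not_exists]
      intro e he
      obtain ⟨x, hx, hne⟩ := hsep e
      have : (⟨x, (hK x).2 hx⟩ : K) ∈ C e := he ▸ Submodule.mem_top
      exact hne (sub_eq_zero.1 this)
    obtain ⟨q, hq⟩ := (Set.ne_univ_iff_exists_notMem _).1
      (Subspace.biUnion_ne_univ_of_top_notMem hC)
    simp only [Finset.mem_image, Finset.mem_univ, true_and, Set.iUnion_exists,
      Set.iUnion_iUnion_eq', Set.mem_iUnion, SetLike.mem_coe, not_exists] at hq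
    exact ⟨q, (hK q).1 q.2, fun e h => hq e (sub_eq_zero.2 h)⟩
  choose a ha using fun e => exists_smul_quarterTurn_of_inner_eq_zero (hd0 e) (hq e)
  have ha0 : ∀ e, a e ≠ 0 := fun e h => hqe e (by simpa [h, sub_eq_zero] using ha e)
  refine ⟨q, fun l => quarterTurn (d₀ (Sum.inr l)), ?_⟩
  -- The vertexwise adjoint of the quarter turn. Its dual map turns the vector of every frame row;
  -- the turned edge vectors are rescaled by the `a e` to the differences of `q`, and the normals
  -- are by choice the turned loop vectors.
  let T : (V → Plane) →ₗ[ℝ] (V → Plane) := LinearMap.pi fun v => -quarterTurn ∘ₗ LinearMap.proj v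
  have hT : Function.Surjective T := fun y =>
    ⟨fun v => quarterTurn (y v), funext fun v => by simp [T]⟩
  have h1 := (hmain.map' T.dualMap
    (LinearMap.ker_eq_bot.2 (LinearMap.dualMap_injective_of_surjective hT))).units_smul
    (Sum.elim (fun e => Units.mk0 (a e) (ha0 e)) fun _ => 1)
  have heq : (fun r => G.frameForm r (G.barSliderVector q (fun l => quarterTurn (d₀ (Sum.inr l))) r))
      = (Sum.elim (fun e => Units.mk0 (a e) (ha0 e)) fun _ => 1 : E ⊕ L → ℝˣ) •
        (T.dualMap ∘ fun r => G.frameForm r (Sum.elim (vec d) (fun l => d₀ (Sum.inr l)) r)) := by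
    funext r
    refine LinearMap.ext fun x => ?_
    rcases r with e | l
    · simp [barSliderVector, ha, inner_quarterTurn_left, T, Units.smul_def,
        neg_add_eq_sub]
    · simp [barSliderVector, inner_quarterTurn_left, T]
  rw [heq]
  exact h1

end LoopedGraph

/-! ### Dropping coordinates of a linear map -/

/-- If a linear map to `R → ℝ` is injective but not onto, then some coordinate can be dropped
without losing injectivity. -/
theorem exists_forall_injective_funLeft {R W : Type*} [Finite R] [AddCommGroup W] [Module ℝ W]
    {A : W →ₗ[ℝ] (R → ℝ)} (hinj : Function.Injective A) (hns : ¬ Function.Surjective A) :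
    ∃ r₀, ∀ {R' : Type _} (j : R' → R), (∀ r, r ≠ r₀ → r ∈ Set.range j) →
      Function.Injective (LinearMap.funLeft ℝ ℝ j ∘ₗ A) := by
  classical
  have := Fintype.ofFinite R
  obtain ⟨f, hf0, hf⟩ := Submodule.exists_le_ker_of_lt_top _
    (lt_top_iff_ne_top.2 (mt LinearMap.range_eq_top.1 hns))
  -- A coordinate that occurs in a linear relation satisfied on the range is determined by the
  -- others, so it can be dropped.
  obtain ⟨r₀, hr₀⟩ : ∃ r, f (Pi.single r 1) ≠ 0 := by
    by_contra! h
    exact hf0 (LinearMap.pi_ext' fun r => LinearMap.ext_ring (by simpa using h r))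
  refine ⟨r₀, fun j hj => ?_⟩
  rw [injective_iff_map_eq_zero]
  intro x hx
  have hAx : A x = (A x r₀) • Pi.single r₀ 1 := by
    funext r
    rcases eq_or_ne r r₀ with rfl | hr
    · simp
    · obtain ⟨s, rfl⟩ := hj r hr
      have : A x (j s) = 0 := congrFun hx s
      simp [this, hr]
  have h1 : f (A x) = 0 := hf ⟨x, rfl⟩
  rw [hAx, map_smul, smul_eq_mul, mul_eq_zero, or_iff_left hr₀] at h1
  rw [h1, zero_smul] at hAx
  exact hinj (by rw [hAx, map_zero])

theorem funLeft_comp_surjective {R R' W : Type*} [AddCommGroup W] [Module ℝ W]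
    {A : W →ₗ[ℝ] (R → ℝ)} (hA : Function.Surjective A) {j : R' → R} (hj : Function.Injective j) :
    Function.Surjective (LinearMap.funLeft ℝ ℝ j ∘ₗ A) :=
  (LinearMap.funLeft_surjective_of_injective ℝ ℝ j hj).comp hA

theorem funLeft_comp_not_injective {R R' W : Type*} [AddCommGroup W] [Module ℝ W]
    {A : W →ₗ[ℝ] (R → ℝ)} (hA : Function.Surjective A) {j : R' → R} {r₀ : R}
    (hj : ∀ s, j s ≠ r₀) : ¬ Function.Injective (LinearMap.funLeft ℝ ℝ j ∘ₗ A) := by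
  classical
  intro hinj
  obtain ⟨x, hx⟩ := hA (Pi.single r₀ 1)
  have h0 : x = 0 := hinj (by
    rw [map_zero]
    funext s
    simp [LinearMap.funLeft_apply, hx, hj s])
  rw [h0, map_zero] at hx
  simpa using congrFun hx r₀

/-! ### Independent rows force sparsity -/

namespace LoopedGraph

variable {V E L : Type*}

/-- Extension of configurations on a set of vertices by zero. -/
noncomputable def extendByZero (S : Finset V) : (S → Plane) →ₗ[ℝ] (V → Plane) :=
  open Classical in
  LinearMap.pi fun v => if h : v ∈ S then LinearMap.proj (⟨v, h⟩ : S) else 0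

theorem extendByZero_apply_of_mem {S : Finset V} (y : S → Plane) {v : V} (h : v ∈ S) :
    extendByZero S y v = y ⟨v, h⟩ := by
  simp [extendByZero, h]

/-- If the rigidity map is onto, then the number of edges and loops in a family supported on `S`
is `2 |S|` minus the dimension of the space of infinitesimal motions of `S`. -/
theorem card_add_finrank_ker_eq [Finite E] [Finite L] (G : LoopedGraph V E L)
    {p : V → Plane} {ν : L → Plane} (hs : Function.Surjective (G.rigidityMap p ν))
    {I : Type*} [Finite I] {j : I → E ⊕ L} (hj : Function.Injective j) (S : Finset V)
    (hS : ∀ i x y, (∀ v ∈ S, x v = y v) → G.displacement (j i) x = G.displacement (j i) y) :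
    Nat.card I + Module.finrank ℝ (LinearMap.ker
      (LinearMap.funLeft ℝ ℝ j ∘ₗ G.rigidityMap p ν ∘ₗ extendByZero S)) = 2 * S.card := by
  have := Fintype.ofFinite I
  have hsurj : Function.Surjective
      (LinearMap.funLeft ℝ ℝ j ∘ₗ G.rigidityMap p ν ∘ₗ extendByZero S) := by
    intro y
    obtain ⟨x, rfl⟩ := funLeft_comp_surjective hs hj y
    refine ⟨fun v => x v, funext fun i => ?_⟩
    simp only [LinearMap.comp_apply, LinearMap.funLeft_apply, rigidityMap_apply]
    rw [hS i _ x fun v hv => extendByZero_apply_of_mem _ hv]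
  have h := LinearMap.finrank_range_add_finrank_ker
    (LinearMap.funLeft ℝ ℝ j ∘ₗ G.rigidityMap p ν ∘ₗ extendByZero S)
  rw [LinearMap.range_eq_top.2 hsurj, finrank_top, Module.finrank_pi, Module.finrank_pi_fintype] at h
  simp only [finrank_euclideanSpace, Fintype.card_fin, Finset.sum_const, Finset.card_univ,
    smul_eq_mul, Fintype.card_coe] at h
  rw [Nat.card_eq_fintype_card, h, mul_comm]

/-- Independent rows supported on `S` number `2 |S|` minus the dimension of the motions of `S` that
they allow; edge rows always allow translations and rotations. -/
theorem isGradedSparse_of_surjective [Finite E] [Finite L] (G : LoopedGraph V E L)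
    {p : V → Plane} {ν : L → Plane} (hs : Function.Surjective (G.rigidityMap p ν))
    (hp : ∀ e, p (G.src e) ≠ p (G.tgt e)) : G.IsGradedSparse where
  edges_sparse S hS2 := by
    have hj : Function.Injective
        (fun e : G.inducedEdges S => (Sum.inl (e : E) : E ⊕ L)) := fun a b h =>
      Subtype.ext (Sum.inl_injective h)
    have hmem : ∀ e : G.inducedEdges S, G.src e ∈ S ∧ G.tgt e ∈ S := fun e =>
      (G.mem_inducedEdges S e).1 e.2
    have h := G.card_add_finrank_ker_eq hs hj S (by
      intro e x y hxy
      simp [hxy _ (hmem e).1, hxy _ (hmem e).2])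
    rw [Nat.card_coe_set_eq] at h
    rcases (G.inducedEdges S).eq_empty_or_nonempty with hem | ⟨e₀, he₀⟩
    -- With no edge the points of `S` may all coincide and the rotation is lost, but `|S| ≥ 2`
    -- suffices.
    · rw [hem, Set.ncard_empty]
      omega
    · have he₀' := hmem ⟨e₀, he₀⟩
      -- A translation plus an infinitesimal rotation. It is injective because the ends of `e₀` are
      -- at distinct points, which rules out a rotation cancelled by a translation.
      let τ : Plane × ℝ →ₗ[ℝ] (S → Plane) := LinearMap.pi fun v =>
        LinearMap.fst ℝ Plane ℝ + (LinearMap.snd ℝ Plane ℝ).smulRight (quarterTurn (p v))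
      have hτ : ∀ t c v, τ (t, c) v = t + c • quarterTurn (p v) := fun _ _ _ => rfl
      have hτi : Function.Injective τ := by
        rw [injective_iff_map_eq_zero]
        rintro ⟨t, c⟩ h0
        have h1 := congrFun h0 ⟨_, he₀'.1⟩
        have h2 := congrFun h0 ⟨_, he₀'.2⟩
        rw [hτ] at h1 h2
        have h3 : c • quarterTurn (p (G.src e₀) - p (G.tgt e₀)) = 0 := by
          rw [map_sub, smul_sub, sub_eq_zero]
          exact add_left_cancel (h1.trans h2.symm)
        have hc : c = 0 := by
          refine (smul_eq_zero.1 h3).resolve_right fun h4 => hp e₀ ?_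
          have h5 := quarterTurn_quarterTurn (p (G.src e₀) - p (G.tgt e₀))
          rw [h4, map_zero] at h5
          exact sub_eq_zero.1 (neg_eq_zero.1 h5.symm)
        subst hc
        simpa using h1
      have hτk : ∀ z, τ z ∈ LinearMap.ker (LinearMap.funLeft ℝ ℝ
          (fun e : G.inducedEdges S => (Sum.inl (e : E) : E ⊕ L)) ∘ₗ
            G.rigidityMap p ν ∘ₗ extendByZero S) := by
        rintro ⟨t, c⟩
        rw [LinearMap.mem_ker]
        funext e
        simp only [LinearMap.comp_apply, LinearMap.funLeft_apply, rigidityMap_apply,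
          displacement_inl, extendByZero_apply_of_mem _ (hmem e).1,
          extendByZero_apply_of_mem _ (hmem e).2, hτ, barSliderVector, Sum.elim_inl,
          add_sub_add_left_eq_sub, ← smul_sub, ← map_sub, inner_smul_right,
          inner_quarterTurn_self, mul_zero, Pi.zero_apply]
      have h3 := LinearMap.finrank_le_finrank_of_injective
        (f := τ.codRestrict _ hτk) fun a b hab => hτi (congrArg Subtype.val hab)
      rw [Module.finrank_prod] at h3
      simp only [finrank_euclideanSpace, Fintype.card_fin, Module.finrank_self] at h3
      omega
  sparse S := by
    have hj : Function.Injective (Sum.map Subtype.val Subtype.val :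
        G.inducedEdges S ⊕ G.inducedLoops S → E ⊕ L) :=
      Subtype.val_injective.sumMap Subtype.val_injective
    have h := G.card_add_finrank_ker_eq hs hj S (by
      rintro (e | l) x y hxy
      · have := (G.mem_inducedEdges S e).1 e.2
        simp [hxy _ this.1, hxy _ this.2]
      · simpa using hxy _ l.2)
    rw [Nat.card_sum, Nat.card_coe_set_eq, Nat.card_coe_set_eq] at h
    omega

end LoopedGraph

/-! ### Pinned realizations and the rigidity map -/

namespace BarSliderFramework

variable {V E L : Type*}

/-- Half the squared lengths of the edges and the positions of the loops along their normals. -/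
noncomputable def measurement (F : BarSliderFramework V E L) (q : V → Plane) : E ⊕ L → ℝ :=
  Sum.elim (fun e => ‖q (F.graph.src e) - q (F.graph.tgt e)‖ ^ 2 / 2)
    fun l => inner ℝ (q (F.graph.base l)) (F.normal l)

theorem mem_configurationSpace_iff (F : BarSliderFramework V E L) (q : V → Plane) :
    q ∈ F.configurationSpace ↔ F.measurement q = Sum.elim (fun e => F.lengthSq e / 2) F.offset := by
  constructor
  · rintro ⟨h1, h2⟩
    funext r
    rcases r with e | l
    · simp [measurement, h1 e _ _ (F.graph.ends_eq e)]
    · exact h2 l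
  · intro h
    refine ⟨fun e i j hij => ?_, fun l => congrFun h (Sum.inr l)⟩
    have h1 : ‖q (F.graph.src e) - q (F.graph.tgt e)‖ ^ 2 / 2 = F.lengthSq e / 2 :=
      congrFun h (Sum.inl e)
    rw [F.graph.ends_eq, Sym2.eq_iff] at hij
    rcases hij with ⟨rfl, rfl⟩ | ⟨rfl, rfl⟩
    · linarith
    · rw [norm_sub_rev]
      linarith

theorem isPinned_iff (F : BarSliderFramework V E L) {p : V → Plane}
    (hp : p ∈ F.configurationSpace) :
    F.IsPinned p ↔ ∀ᶠ q in 𝓝 p, F.measurement q = F.measurement p → q = p := by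
  rw [IsPinned, and_iff_right hp]
  simp only [mem_configurationSpace_iff] at hp ⊢
  rw [hp]

theorem src_ne_tgt_of_mem (F : BarSliderFramework V E L) {p : V → Plane}
    (hp : p ∈ F.configurationSpace) (e : E) : p (F.graph.src e) ≠ p (F.graph.tgt e) := by
  intro h
  have h1 := hp.1 e _ _ (F.graph.ends_eq e)
  have h2 := F.lengthSq_pos e
  rw [h, sub_self, norm_zero] at h1
  norm_num at h1
  linarith

/-- The half in `measurement` cancels the factor two from differentiating a squared length, so the
derivative is exactly the rigidity map. -/
theorem hasFDerivAt_measurement [Fintype V] [Fintype E] [Fintype L]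
    (F : BarSliderFramework V E L) (q : V → Plane) :
    HasFDerivAt F.measurement
      (LinearMap.toContinuousLinearMap (F.graph.rigidityMap q F.normal)) q := by
  rw [hasFDerivAt_pi']
  rintro (e | l)
  · have h := ((LinearMap.toContinuousLinearMap
      (F.graph.displacement (Sum.inl e))).hasFDerivAt (x := q)).norm_sq.mul_const (1 / 2 : ℝ)
    have heq : (fun x => F.measurement x (Sum.inl e)) = fun x =>
        ‖LinearMap.toContinuousLinearMap (F.graph.displacement (Sum.inl e)) x‖ ^ 2 * (1 / 2) := by
      funext x
      simp [measurement, div_eq_mul_inv]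
    rw [heq]
    refine h.congr_fderiv (ContinuousLinearMap.ext fun x => ?_)
    simp [LoopedGraph.rigidityMap_apply, LoopedGraph.barSliderVector, inner_sub_left]
  · have h := (((innerSL ℝ (F.normal l)).comp (LinearMap.toContinuousLinearMap
      (F.graph.displacement (Sum.inr l)))).hasFDerivAt (x := q))
    have heq : (fun x => F.measurement x (Sum.inr l)) = (innerSL ℝ (F.normal l)).comp
        (LinearMap.toContinuousLinearMap (F.graph.displacement (Sum.inr l))) := by
      funext x
      simp [measurement, real_inner_comm]
    rw [heq]
    exact h

theorem contDiff_measurement [Fintype V] [Fintype E] [Fintype L] (F : BarSliderFramework V E L) :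
    ContDiff ℝ 1 F.measurement := by
  rw [contDiff_pi]
  rintro (e | l)
  · exact (((contDiff_apply ℝ Plane (F.graph.src e)).sub
      (contDiff_apply ℝ Plane (F.graph.tgt e))).norm_sq ℝ).div_const 2
  · exact (contDiff_apply ℝ Plane (F.graph.base l)).inner ℝ contDiff_const

theorem isPinned_of_injective [Fintype V] [Finite E] [Finite L] (F : BarSliderFramework V E L)
    {p : V → Plane} (hp : p ∈ F.configurationSpace)
    (h : Function.Injective (F.graph.rigidityMap p F.normal)) : F.IsPinned p := by
  have := Fintype.ofFinite E
  have := Fintype.ofFinite L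
  exact (F.isPinned_iff hp).2 (eventually_eq_of_fderiv_injective (F.hasFDerivAt_measurement p) h)

theorem not_isPinned_of_rank_le [Fintype V] [Finite E] [Finite L] (F : BarSliderFramework V E L)
    {p : V → Plane} (hp : p ∈ F.configurationSpace)
    (hrank : ∀ q, Module.finrank ℝ (LinearMap.range (F.graph.rigidityMap q F.normal)) ≤
      Module.finrank ℝ (LinearMap.range (F.graph.rigidityMap p F.normal)))
    (h : ¬ Function.Injective (F.graph.rigidityMap p F.normal)) : ¬ F.IsPinned p := by
  have := Fintype.ofFinite E
  have := Fintype.ofFinite L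
  rw [F.isPinned_iff hp]
  exact not_eventually_eq_of_rank_le F.hasFDerivAt_measurement F.contDiff_measurement hrank h

/-- A map that is onto has maximal rank automatically. This serves the frameworks with a row
deleted, for which genericity is not assumed. -/
theorem not_isPinned_of_surjective [Fintype V] [Finite E] [Finite L]
    (F : BarSliderFramework V E L) {p : V → Plane} (hp : p ∈ F.configurationSpace)
    (hs : Function.Surjective (F.graph.rigidityMap p F.normal))
    (h : ¬ Function.Injective (F.graph.rigidityMap p F.normal)) : ¬ F.IsPinned p := by
  refine F.not_isPinned_of_rank_le hp (fun q => ?_) h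
  rw [LinearMap.range_eq_top.2 hs, finrank_top]
  exact Submodule.finrank_le _

theorem mem_configurationSpace_deleteEdge {F : BarSliderFramework V E L} {p : V → Plane}
    (hp : p ∈ F.configurationSpace) (e : E) : p ∈ (F.deleteEdge e).configurationSpace :=
  ⟨fun e' => hp.1 e', hp.2⟩

theorem mem_configurationSpace_deleteLoop {F : BarSliderFramework V E L} {p : V → Plane}
    (hp : p ∈ F.configurationSpace) (l : L) : p ∈ (F.deleteLoop l).configurationSpace :=
  ⟨hp.1, fun l' => hp.2 l'⟩

theorem rigidityMap_deleteEdge (F : BarSliderFramework V E L) (p : V → Plane) (e : E) :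
    (F.deleteEdge e).graph.rigidityMap p (F.deleteEdge e).normal =
      LinearMap.funLeft ℝ ℝ (Sum.map Subtype.val id) ∘ₗ F.graph.rigidityMap p F.normal := by
  refine LinearMap.ext fun x => funext fun r => ?_
  rcases r with e | l <;> rfl

theorem rigidityMap_deleteLoop (F : BarSliderFramework V E L) (p : V → Plane) (l : L) :
    (F.deleteLoop l).graph.rigidityMap p (F.deleteLoop l).normal =
      LinearMap.funLeft ℝ ℝ (Sum.map id Subtype.val) ∘ₗ F.graph.rigidityMap p F.normal := by
  refine LinearMap.ext fun x => funext fun r => ?_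
  rcases r with e | l <;> rfl

/-- A minimally pinned realization at which the rank is maximal has a bijective rigidity map. -/
theorem IsMinimallyPinned.bijective [Fintype V] [Finite E] [Finite L]
    {F : BarSliderFramework V E L} {p : V → Plane} (h : F.IsMinimallyPinned p)
    (hgen : F.IsGeneric p) : Function.Bijective (F.graph.rigidityMap p F.normal) := by
  have hp := h.1.1
  have hinj : Function.Injective (F.graph.rigidityMap p F.normal) := by
    by_contra hni
    refine F.not_isPinned_of_rank_le hp (fun q => ?_) hni h.1
    simpa only [LoopedGraph.rigidityMatrix_rank] using hgen q F.normal
  refine ⟨hinj, ?_⟩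
  by_contra hns
  -- Without surjectivity some row is redundant for injectivity, and its edge or loop can be removed
  -- with the realization still pinned.
  obtain ⟨r₀, hr₀⟩ := exists_forall_injective_funLeft hinj hns
  rcases r₀ with e | l
  · refine h.2.1 e ((F.deleteEdge e).isPinned_of_injective
      (mem_configurationSpace_deleteEdge hp e) ?_)
    rw [rigidityMap_deleteEdge]
    refine hr₀ _ ?_
    rintro (e' | l) hr
    · exact ⟨Sum.inl ⟨e', fun h => hr (congrArg Sum.inl h)⟩, rfl⟩
    · exact ⟨Sum.inr l, rfl⟩
  · refine h.2.2 l ((F.deleteLoop l).isPinned_of_injective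
      (mem_configurationSpace_deleteLoop hp l) ?_)
    rw [rigidityMap_deleteLoop]
    refine hr₀ _ ?_
    rintro (e | l') hr
    · exact ⟨Sum.inl e, rfl⟩
    · exact ⟨Sum.inr ⟨l', fun h => hr (congrArg Sum.inr h)⟩, rfl⟩

/-- Deleting a row keeps the map onto but creates a kernel: the preimage of the deleted unit vector.
-/
theorem isMinimallyPinned_of_bijective [Fintype V] [Finite E] [Finite L]
    {F : BarSliderFramework V E L} {p : V → Plane} (hp : p ∈ F.configurationSpace)
    (h : Function.Bijective (F.graph.rigidityMap p F.normal)) : F.IsMinimallyPinned p := by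
  refine ⟨F.isPinned_of_injective hp h.1, fun e => ?_, fun l => ?_⟩
  · apply not_isPinned_of_surjective _ (mem_configurationSpace_deleteEdge hp e)
    · rw [rigidityMap_deleteEdge]
      exact funLeft_comp_surjective h.2 (Subtype.val_injective.sumMap Function.injective_id)
    · rw [rigidityMap_deleteEdge]
      refine funLeft_comp_not_injective h.2 (r₀ := Sum.inl e) ?_
      rintro (e' | l) heq
      · exact e'.2 (Sum.inl_injective heq)
      · cases heq
  · apply not_isPinned_of_surjective _ (mem_configurationSpace_deleteLoop hp l)
    · rw [rigidityMap_deleteLoop]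
      exact funLeft_comp_surjective h.2 (Function.injective_id.sumMap Subtype.val_injective)
    · rw [rigidityMap_deleteLoop]
      refine funLeft_comp_not_injective h.2 (r₀ := Sum.inr l) ?_
      rintro (e | l') heq
      · cases heq
      · exact l'.2 (Sum.inr_injective heq)

end BarSliderFramework

/-! ### The theorem -/

theorem theorem2 {V E L : Type*} [Fintype V] [Fintype E] [Fintype L]
    (F : BarSliderFramework V E L) (p : V → Plane)
    (hp : p ∈ F.configurationSpace) (hgen : F.IsGeneric p) :
    F.IsMinimallyPinned p ↔ F.graph.IsLoopedLaman := by
  have hV : Module.finrank ℝ (V → Plane) = 2 * Fintype.card V := by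
    rw [Module.finrank_pi_fintype]
    simp [mul_comm]
  have hR : Module.finrank ℝ (E ⊕ L → ℝ) = Fintype.card E + Fintype.card L := by
    rw [Module.finrank_pi, Fintype.card_sum]
  constructor
  · intro h
    have hbij := h.bijective hgen
    refine ⟨F.graph.isGradedSparse_of_surjective hbij.2 (F.src_ne_tgt_of_mem hp), ?_⟩
    rw [← hR, ← hV]
    exact (LinearEquiv.ofBijective _ hbij).finrank_eq.symm
  · intro h
    refine F.isMinimallyPinned_of_bijective hp ?_
    -- Full row rank at some points and normals passes to `p` and `F.normal` by genericity; the
    -- matrix is square, so the map at `p` is also injective.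
    obtain ⟨q, ν, hli⟩ := h.toIsGradedSparse.exists_linearIndependent
    have hs : Function.Surjective (F.graph.rigidityMap q ν) :=
      surjective_pi_of_linearIndependent hli
    have hrank := hgen q ν
    rw [LoopedGraph.rigidityMatrix_rank, LoopedGraph.rigidityMatrix_rank,
      LinearMap.range_eq_top.2 hs, finrank_top] at hrank
    have hsp : Function.Surjective (F.graph.rigidityMap p F.normal) :=
      LinearMap.range_eq_top.1 (Submodule.eq_top_of_finrank_eq
        (le_antisymm (Submodule.finrank_le _) hrank))
    exact ⟨(LinearMap.injective_iff_surjective_of_finrank_eq_finrank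
      (by rw [hV, hR, h.tight])).2 hsp, hsp⟩
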